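/- Conventions. A problem is a language $L\subseteq\{0,1\}^*$. $\mathrm P$ is the class of languages decided by a deterministic single-tape Turing machine (DTM) in time $T(|w|)$ for some polynomial $T$, and $L$ is P-complete if $L\in\mathrm P$ and every language in $\mathrm P$ is many-one reducible to $L$ by a function computable by a deterministic Turing machine in logarithmic space. A Boolean circuit is a finite directed acyclic graph whose nodes are labelled by input variables, constants $0,1$ or gates $\neg,\wedge,\vee$ (of fan-in at most two), with one output node; its size $|C|$ is its number of nodes; it is monotone if it has no $\neg$ gate. A circuit with $n$ inputs decides $L$ at length $n$ if it accepts exactly those words of length $n$ that lie in $L$. The flattening $\phi(w)$ of a word $w$ is obtained by replacing each letter: $0\mapsto 10$, $1\mapsto 01$. The flattened problem of $L$ has the words $\phi(w)$, $w\in\{0,1\}^*$, as its instances, and $\phi(w)$ is a yes-instance if and only if $w\in L$; a circuit with $2n$ inputs decides it at length $2n$ if, for all $w\in\{0,1\}^n$, it accepts $\phi(w)$ if and only if $w\in L$. (Nothing is required on words that are not flattened words.) For a DTM $M$ and $n,\tau\in\mathbb N$, let $B_{M,n,\tau}$ be the standard Boolean circuit obtained from $M$: its nodes express the contents (tape symbol,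 and state if the head is there) of the cells of the table of the first $\tau$ steps of $M$ on an input of length $n$, each row being computed locally from the preceding one, and it accepts if the accepting state occurs in the last row. Theorem. There is a polynomial $q$ such that for every P-complete problem $L$ there is a family $(C_n)_{n\ge 0}$ of monotone circuits, $C_n$ having $2n$ inputs, with the following properties. 1. For every $n$, $C_n$ decides the flattened problem of $L$ at length $2n$. 2. There is a polynomial $p$ with $|C_n|\le p(n)$ for all $n$. 3. For every $n$ and every Boolean circuit $B$ with $n$ inputs that decides $L$ at length $n$, $|C_n|\le q(|B|)$. 4. If $M$ is a DTM that decides $L$ in polynomial time $T$, then for every $n$ the Boolean circuit $B_{M,n,T(n)}$ obtained from $M$ decides $L$ at length $n$ and $|C_n|\le q(|B_{M,n,T(n)}|)$; moreover $|B_{M,n,T(n)}|\le r(n)$ for all $n$, for some polynomial $r$. -/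

import Mathlib

/-! ### Boolean circuits -/

/-- Label of a node of a Boolean circuit with `n` input variables whose nodes are the
elements of `V`: an input variable, a constant, or a gate `¬`, `∧`, `∨` fed by nodes. -/
inductive Gate (n : ℕ) (V : Type) : Type
  | input (i : Fin n)
  | const (b : Bool)
  | not (a : V)
  | and (a b : V)
  | or (a b : V)

/-- The nodes feeding a gate. -/
def Gate.args {n : ℕ} {V : Type} : Gate n V → List V
  | .input _ => []
  | .const _ => []
  | .not a => [a]
  | .and a b => [a, b]
  | .or a b => [a, b]

/-- The output of a gate, for the input `x` and the values `val` of the nodes. -/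
def Gate.eval {n : ℕ} {V : Type} (x : Fin n → Bool) (val : V → Bool) : Gate n V → Bool
  | .input i => x i
  | .const b => b
  | .not a => !val a
  | .and a b => val a && val b
  | .or a b => val a || val b

/-- A Boolean circuit with `n` inputs and one output: a finite acyclic directed graph whose
nodes are labelled by input variables, constants and gates of fan-in at most two. -/
structure Circuit (n : ℕ) where
  Node : Type
  [finite : Finite Node]
  gate : Node → Gate n Node
  acyclic : WellFounded fun u v : Node => u ∈ (gate v).args
  out : Node

namespace Circuit

variable {n : ℕ}

/-- The size of a circuit is its number of nodes. -/
noncomputable def size (C : Circuit n) : ℕ := Nat.card C.Node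

/-- The value that a node takes on the input `x`, by recursion along the graph. -/
noncomputable def val (C : Circuit n) (x : Fin n → Bool) : C.Node → Bool :=
  C.acyclic.fix fun v ih =>
    match h : C.gate v with
    | .input i => x i
    | .const b => b
    | .not a => !ih a (by simp [h, Gate.args])
    | .and a b => ih a (by simp [h, Gate.args]) && ih b (by simp [h, Gate.args])
    | .or a b => ih a (by simp [h, Gate.args]) || ih b (by simp [h, Gate.args])

theorem val_eq (C : Circuit n) (x : Fin n → Bool) (v : C.Node) :
    C.val x v = (C.gate v).eval x (C.val x) := by
  rw [val, WellFounded.fix_eq]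
  split <;> rename_i h <;> simp only [h, Gate.eval]

/-- The circuit accepts the word `w`. (Only used for words of length `n`.) -/
def Accepts (C : Circuit n) (w : List Bool) : Prop :=
  C.val (fun i => w.getD i false) C.out = true

/-- Among the words of length `n` that belong to the set `S` of instances, the circuit accepts
exactly the members of `L`. -/
def DecidesOn (C : Circuit n) (S : Set (List Bool)) (L : Language Bool) : Prop :=
  ∀ w ∈ S, w.length = n → (C.Accepts w ↔ w ∈ L)

/-- The circuit decides `L` on all words of length `n`. -/
def Decides (C : Circuit n) (L : Language Bool) : Prop :=
  C.DecidesOn Set.univ L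

/-- A monotone circuit has no negation gate. -/
def IsMonotone (C : Circuit n) : Prop :=
  ∀ v a : C.Node, C.gate v ≠ .not a

end Circuit

/-! ### Flattening -/

/-- The flattening of a word: `0 ↦ 10`, `1 ↦ 01`. -/
def flatten (w : List Bool) : List Bool :=
  w.flatMap fun b => [!b, b]

/-- The yes-instances of the flattened problem of `L`; its instances are the words in the range
of `flatten`. -/
def flattened (L : Language Bool) : Language Bool :=
  {u | ∃ w ∈ L, flatten w = u}

/-! ### Deterministic Turing machines and the class P -/

/-- A deterministic single-tape Turing machine for words over `{0, 1}`. The map `sym` embeds the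
blank (`none`) and the two input symbols in the tape alphabet. The head moves by `-1`, `0`
or `1`. -/
structure DTM where
  Q : Type
  Γ : Type
  [fintypeQ : Fintype Q]
  [decEqQ : DecidableEq Q]
  [fintypeΓ : Fintype Γ]
  [decEqΓ : DecidableEq Γ]
  sym : Option Bool ↪ Γ
  start : Q
  accept : Q
  reject : Q
  accept_ne_reject : accept ≠ reject
  δ : Q → Γ → Q × Γ × SignType

attribute [instance] DTM.fintypeQ DTM.decEqQ DTM.fintypeΓ DTM.decEqΓ

namespace DTM

/-- A configuration: state, position of the head, contents of the two-way infinite tape. -/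
structure Cfg (M : DTM) where
  state : M.Q
  head : ℤ
  tape : ℤ → M.Γ

/-- What the machine does in state `q` reading `a`. In the two halting states nothing happens
any more. -/
def act (M : DTM) (q : M.Q) (a : M.Γ) : M.Q × M.Γ × SignType :=
  if q = M.accept ∨ q = M.reject then (q, a, 0) else M.δ q a

/-- One step of the machine. -/
def step (M : DTM) (c : M.Cfg) : M.Cfg where
  state := (M.act c.state (c.tape c.head)).1
  head := c.head + ((M.act c.state (c.tape c.head)).2.2 : ℤ)
  tape := Function.update c.tape c.head (M.act c.state (c.tape c.head)).2.1

/-- The initial configuration: the word `w` stands on the cells `0, …, |w| - 1`, all other cells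
are blank, the head is on cell `0`. -/
def init (M : DTM) (w : List Bool) : M.Cfg where
  state := M.start
  head := 0
  tape p := M.sym (if 0 ≤ p then w[p.toNat]? else none)

/-- The machine decides `L` in time `T`: on each word `w` it halts after at most `T |w|` steps,
in state `accept` if `w ∈ L` and in state `reject` otherwise. (Halting configurations do not
change, so the configuration after exactly `T |w|` steps tells.) -/
def DecidesInTime (M : DTM) (L : Language Bool) (T : ℕ → ℕ) : Prop :=
  ∀ w : List Bool,
    (w ∈ L → (M.step^[T w.length] (M.init w)).state = M.accept) ∧
    (w ∉ L → (M.step^[T w.length] (M.init w)).state = M.reject)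

end DTM

/-- The class P. -/
def InP (L : Language Bool) : Prop :=
  ∃ (M : DTM) (T : Polynomial ℕ), M.DecidesInTime L fun n => T.eval n

/-! ### Logarithmic space reductions and P-completeness -/

/-- A deterministic Turing machine with a two-way read-only input tape, a work tape and a
write-only output tape. In each step it may append one bit to the output. -/
structure Transducer where
  Q : Type
  Γ : Type
  [fintypeQ : Fintype Q]
  [decEqQ : DecidableEq Q]
  [fintypeΓ : Fintype Γ]
  blank : Γ
  start : Q
  halt : Q
  δ : Q → Option Bool → Γ → Q × Γ × SignType × SignType × Option Bool

attribute [instance] Transducer.fintypeQ Transducer.decEqQ Transducer.fintypeΓ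

namespace Transducer

/-- A configuration. The input head is on one of the cells `0, …, |w| + 1`, where the cells `0`
and `|w| + 1` carry end markers and the cell `i + 1` carries the `i`-th letter of the input. -/
structure Cfg (M : Transducer) where
  state : M.Q
  inputHead : ℕ
  workHead : ℤ
  work : ℤ → M.Γ
  output : List Bool

/-- The input symbol under the input head, `none` for an end marker. -/
def read (w : List Bool) : ℕ → Option Bool
  | 0 => none
  | i + 1 => w[i]?

/-- One step of the machine on the input `w`. The input head cannot pass the end markers. -/
def step (M : Transducer) (w : List Bool) (c : M.Cfg) : M.Cfg :=
  if c.state = M.halt then c else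
    match M.δ c.state (read w c.inputHead) (c.work c.workHead) with
    | (q, a, d₁, d₂, o) =>
      { state := q
        inputHead := min (w.length + 1) ((c.inputHead : ℤ) + (d₁ : ℤ)).toNat
        workHead := c.workHead + (d₂ : ℤ)
        work := Function.update c.work c.workHead a
        output := c.output ++ o.toList }

/-- The initial configuration. -/
def init (M : Transducer) : M.Cfg where
  state := M.start
  inputHead := 0
  workHead := 0
  work _ := M.blank
  output := []

end Transducer

/-- The function `f` is computed by a machine that halts on every input `w` and whose work head
stays within `O(log |w|)` cells. -/
def LogspaceComputable (f : List Bool → List Bool) : Prop :=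
  ∃ (M : Transducer) (c : ℕ), ∀ w : List Bool,
    (∀ t : ℕ, ((M.step w)^[t] M.init).workHead.natAbs ≤ c * (Nat.log 2 w.length + 1)) ∧
    ∃ t : ℕ, ((M.step w)^[t] M.init).state = M.halt ∧ ((M.step w)^[t] M.init).output = f w

/-- Many-one reducibility in logarithmic space. -/
def LogspaceReducible (A B : Language Bool) : Prop :=
  ∃ f : List Bool → List Bool, LogspaceComputable f ∧ ∀ w, w ∈ A ↔ f w ∈ B

/-- P-completeness, under logarithmic space reductions. -/
def PComplete (L : Language Bool) : Prop :=
  InP L ∧ ∀ A : Language Bool, InP A → LogspaceReducible A L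

/-! ### The Boolean circuit obtained from a Turing machine

The rows of the computation table are the configurations at times `0, …, τ`. Column `p` of the
table is cell `p - (τ + 1)` of the tape, so that the columns `0, …, 2 τ + 2` cover all cells that
the head can reach in `τ` steps, and one cell more on both sides, which never changes. -/

namespace DTM

/-- The content of a cell in the table: the tape symbol, and the state if the head is there. -/
abbrev Cell (M : DTM) : Type := Option M.Q × M.Γ

/-- The state in which the head leaves the cell `k` in direction `d`, if it does. -/
def leave (M : DTM) (k : M.Cell) (d : SignType) : Option M.Q :=
  k.1.bind fun q => if (M.act q k.2).2.2 = d then some (M.act q k.2).1 else none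

/-- The next content of a cell, from the present contents of its left neighbour, of itself and
of its right neighbour. -/
def next (M : DTM) (e : M.Cell × M.Cell × M.Cell) : M.Cell :=
  (((M.leave e.1 1).or (M.leave e.2.1 0)).or (M.leave e.2.2 (-1)),
    match e.2.1.1 with
    | some q => (M.act q e.2.1.2).2.1
    | none => e.2.1.2)

/-- The content of the cell `p` of the tape at time `0` if the symbol `s` stands there. -/
def initCell (M : DTM) (p : ℤ) (s : Option Bool) : M.Cell :=
  (if p = 0 then some M.start else none, M.sym s)

/-- Number of triples of cell contents. -/
abbrev numTriples (M : DTM) : ℕ := Fintype.card (M.Cell × M.Cell × M.Cell)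

/-- Number of possible accepting entries of the last row of the table. -/
abbrev numFinal (M : DTM) (τ : ℕ) : ℕ := Fintype.card (Fin (2 * τ + 3) × M.Γ)

/-- The nodes of the circuit. -/
inductive TableNode (M : DTM) (n τ : ℕ) : Type
  /-- input bit number `i` equals `b` -/
  | lit (i : Fin n) (b : Bool)
  /-- at time `t`, column `p` has content `k` -/
  | cell (t : Fin (τ + 1)) (p : Fin (2 * τ + 3)) (k : M.Cell)
  /-- at time `t`, the columns `j` and `j + 1` have contents `l` and `c` -/
  | pair (t : Fin τ) (j : Fin (2 * τ + 1)) (l c : M.Cell)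
  /-- at time `t`, the columns `j`, `j + 1`, `j + 2` have the contents `e` -/
  | triple (t : Fin τ) (j : Fin (2 * τ + 1)) (e : M.Cell × M.Cell × M.Cell)
  /-- at time `t`, the columns `j`, `j + 1`, `j + 2` have one of the first `m` triples of
  contents, one that leads to the content `k` of column `j + 1` -/
  | chain (t : Fin τ) (j : Fin (2 * τ + 1)) (k : M.Cell) (m : Fin (M.numTriples + 1))
  /-- one of the first `m` possible accepting entries of the last row is present -/
  | final (m : Fin (M.numFinal τ + 1))

namespace TableNode

variable {M : DTM} {n τ : ℕ}

instance : Finite (TableNode M n τ) := by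
  let S : Type := (Fin n × Bool) ⊕ (Fin (τ + 1) × Fin (2 * τ + 3) × M.Cell) ⊕
    (Fin τ × Fin (2 * τ + 1) × M.Cell × M.Cell) ⊕
    (Fin τ × Fin (2 * τ + 1) × (M.Cell × M.Cell × M.Cell)) ⊕
    (Fin τ × Fin (2 * τ + 1) × M.Cell × Fin (M.numTriples + 1)) ⊕
    Fin (M.numFinal τ + 1)
  let g : S → TableNode M n τ
    | .inl (i, b) => .lit i b
    | .inr (.inl (t, p, k)) => .cell t p k
    | .inr (.inr (.inl (t, j, l, c))) => .pair t j l c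
    | .inr (.inr (.inr (.inl (t, j, e)))) => .triple t j e
    | .inr (.inr (.inr (.inr (.inl (t, j, k, m))))) => .chain t j k m
    | .inr (.inr (.inr (.inr (.inr m)))) => .final m
  refine Finite.of_surjective g fun v => ?_
  cases v with
  | lit i b => exact ⟨.inl (i, b), rfl⟩
  | cell t p k => exact ⟨.inr (.inl (t, p, k)), rfl⟩
  | pair t j l c => exact ⟨.inr (.inr (.inl (t, j, l, c))), rfl⟩
  | triple t j e => exact ⟨.inr (.inr (.inr (.inl (t, j, e)))), rfl⟩
  | chain t j k m => exact ⟨.inr (.inr (.inr (.inr (.inl (t, j, k, m))))), rfl⟩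
  | final m => exact ⟨.inr (.inr (.inr (.inr (.inr m)))), rfl⟩

/-- A gate that copies the value of the node `v`. -/
def copy (v : TableNode M n τ) : Gate n (TableNode M n τ) := .or v v

/-- First row of the table. -/
def initGate (p : Fin (2 * τ + 3)) (k : M.Cell) : Gate n (TableNode M n τ) :=
  if h : τ + 1 ≤ (p : ℕ) ∧ (p : ℕ) - (τ + 1) < n then
    if k = M.initCell ((p : ℤ) - (τ + 1)) (some true) then
      copy (.lit ⟨(p : ℕ) - (τ + 1), h.2⟩ true)
    else if k = M.initCell ((p : ℤ) - (τ + 1)) (some false) then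
      copy (.lit ⟨(p : ℕ) - (τ + 1), h.2⟩ false)
    else .const false
  else .const (decide (k = M.initCell ((p : ℤ) - (τ + 1)) none))

/-- Row `t + 1` of the table, from row `t`. -/
def nextGate (t : Fin τ) (p : Fin (2 * τ + 3)) (k : M.Cell) : Gate n (TableNode M n τ) :=
  if h : 0 < (p : ℕ) ∧ (p : ℕ) < 2 * τ + 2 then
    copy (.chain t ⟨(p : ℕ) - 1, by omega⟩ k (Fin.last _))
  else copy (.cell t.castSucc p k)

/-- The gate at each node. Negations occur only in the literals. -/
noncomputable def gate : TableNode M n τ → Gate n (TableNode M n τ)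
  | .lit i true => .input i
  | .lit i false => .not (.lit i true)
  | .cell t p k => Fin.cases (initGate p k) (fun t => nextGate t p k) t
  | .pair t j l c =>
      .and (.cell t.castSucc ⟨j, by omega⟩ l) (.cell t.castSucc ⟨j + 1, by omega⟩ c)
  | .triple t j e =>
      .and (.pair t j e.1 e.2.1) (.cell t.castSucc ⟨j + 2, by omega⟩ e.2.2)
  | .chain t j k m =>
      Fin.cases (.const false)
        (fun m =>
          if M.next ((Fintype.equivFin _).symm m) = k then
            .or (.chain t j k m.castSucc) (.triple t j ((Fintype.equivFin _).symm m))
          else copy (.chain t j k m.castSucc)) m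
  | .final m =>
      Fin.cases (.const false)
        (fun m =>
          .or (.final m.castSucc)
            (.cell (Fin.last τ) ((Fintype.equivFin (Fin (2 * τ + 3) × M.Γ)).symm m).1
              (some M.accept, ((Fintype.equivFin (Fin (2 * τ + 3) × M.Γ)).symm m).2))) m

/-- A topological numbering of the nodes, by which the circuit is acyclic. -/
def rank : TableNode M n τ → ℕ
  | .lit _ true => 0
  | .lit _ false => 1
  | .cell t _ _ => 2 + t * (M.numTriples + 10)
  | .pair t _ _ _ => 3 + t * (M.numTriples + 10)
  | .triple t _ _ => 4 + t * (M.numTriples + 10)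
  | .chain t _ _ m => 5 + m + t * (M.numTriples + 10)
  | .final m => 3 + τ * (M.numTriples + 10) + m

theorem rank_lt (u v : TableNode M n τ) (h : u ∈ v.gate.args) : u.rank < v.rank := by
  have hc : ∀ (w : TableNode M n τ), u ∈ (copy w).args → u = w := by
    intro w h
    simpa [copy, Gate.args] using h
  cases v with
  | lit i b =>
    cases b
    · obtain rfl : u = .lit i true := by simpa [gate, Gate.args] using h
      simp [rank]
    · simp [gate, Gate.args] at h
  | cell t p k =>
    induction t using Fin.cases with
    | zero =>
      simp only [gate, Fin.cases_zero, initGate] at h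
      split_ifs at h
      · rw [hc _ h]; simp [rank]
      · rw [hc _ h]; simp [rank]
      · simp [Gate.args] at h
      · simp [Gate.args] at h
    | succ t =>
      simp only [gate, Fin.cases_succ, nextGate] at h
      split_ifs at h
      · rw [hc _ h]; simp only [rank, Fin.val_last, Fin.val_succ, add_mul]; omega
      · rw [hc _ h]; simp only [rank, Fin.val_castSucc, Fin.val_succ, add_mul]; omega
  | pair t j l c =>
    simp only [gate, Gate.args, List.mem_cons, List.not_mem_nil, or_false] at h
    rcases h with rfl | rfl <;> simp [rank]
  | triple t j e =>
    simp only [gate, Gate.args, List.mem_cons, List.not_mem_nil, or_false] at h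
    rcases h with rfl | rfl <;> simp [rank]
  | chain t j k m =>
    induction m using Fin.cases with
    | zero => simp [gate, Gate.args] at h
    | succ m =>
      simp only [gate, Fin.cases_succ] at h
      split_ifs at h
      · simp only [Gate.args, List.mem_cons, List.not_mem_nil, or_false] at h
        rcases h with rfl | rfl <;> simp only [rank, Fin.val_castSucc, Fin.val_succ] <;> omega
      · rw [hc _ h]; simp only [rank, Fin.val_castSucc, Fin.val_succ]; omega
  | final m =>
    induction m using Fin.cases with
    | zero => simp [gate, Gate.args] at h
    | succ m =>
      simp only [gate, Fin.cases_succ, Gate.args, List.mem_cons, List.not_mem_nil, or_false] at h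
      rcases h with rfl | rfl <;> simp only [rank, Fin.val_castSucc, Fin.val_succ, Fin.val_last] <;>
        omega

end TableNode

/-- The Boolean circuit obtained from the machine, for inputs of length `n` and `τ` steps. -/
noncomputable def circuit (M : DTM) (n τ : ℕ) : Circuit n where
  Node := TableNode M n τ
  gate := TableNode.gate
  acyclic := Subrelation.wf (fun h => TableNode.rank_lt _ _ h) (measure TableNode.rank).wf
  out := .final (Fin.last _)

end DTM

/-!
The monotone circuits come from the dual-rail construction. In a flattened word every bit `x i`
stands next to its negation, so a circuit `B` can be simulated on flattened words by a monotone
circuit with two nodes `(v, true)` and `(v, false)` for each node `v` of `B`: the first one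
carries the value of `v`, the second one its negation (`Circuit.val_dualRail`). Negations merely
exchange the two rails and, by De Morgan's laws, conjunctions and disjunctions are exchanged on
the negative rail. The simulating circuit has exactly `2 |B|` nodes (`Circuit.size_dualRail`).

For a language `L` in P, let `C n` be the dual-rail version of a Boolean circuit of least size
that decides `L` at length `n`. Every circuit `B` that decides `L` at length `n` then gives
`|C n| ≤ 2 |B|`, so that `q = 2 X` works for all `L` simultaneously. Everything else follows once
the circuits obtained from Turing machines are known to be correct (`DTM.circuit_decides`) and of
polynomial size (`DTM.exists_polynomial_circuit_size_le`): they give the polynomial bound on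
`|C n|`, and they are among the circuits `B`. Correctness holds because row `t` of the table
consists of the contents of the cells at time `t` (`DTM.tableVal_cell`), which rests on the
locality of the machine (`DTM.cellAt_step`) and on the head being at distance at most `t` from its
initial position at time `t` (`DTM.abs_head_le`).
-/

/-! ### Flattened words -/

theorem length_flatten (w : List Bool) : (flatten w).length = 2 * w.length := by
  simp [flatten, mul_comm]

theorem flatten_injective : Function.Injective flatten := by
  intro u
  induction u with
  | nil => intro v h; cases v <;> simp_all [flatten]
  | cons a u ih =>
    intro v h
    cases v with
    | nil => simp [flatten] at h
    | cons b v =>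
      simp only [flatten, List.flatMap_cons, List.cons_append, List.nil_append,
        List.cons.injEq] at h
      rw [h.2.1, ih h.2.2]

theorem flatten_mem_flattened {L : Language Bool} {w : List Bool} :
    flatten w ∈ flattened L ↔ w ∈ L :=
  ⟨fun ⟨_, hu, h⟩ => flatten_injective h ▸ hu, fun h => ⟨w, h, rfl⟩⟩

/-- In a flattened word, letter `2 i + 1` is the bit `i` of the word and letter `2 i` is the
negation of that bit. -/
theorem getD_flatten (w : List Bool) (i : ℕ) (hi : i < w.length) (b : Bool) :
    (flatten w).getD (2 * i + b.toNat) false = (w.getD i false == b) := by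
  induction w generalizing i with
  | nil => simp at hi
  | cons a w ih =>
    cases i with
    | zero => cases a <;> cases b <;> simp [flatten]
    | succ i =>
      have h : flatten (a :: w) = (!a) :: a :: flatten w := by simp [flatten]
      have e : 2 * (i + 1) + b.toNat = 2 * i + b.toNat + 1 + 1 := by ring
      rw [h, e, List.getD_cons_succ, List.getD_cons_succ, List.getD_cons_succ]
      exact ih i (by simpa using hi)

/-! ### Dual-rail circuits -/

/-- The gate that computes whether a gate has the output `b`, for a flattened input, from nodes
`(v, b)` that tell whether the node `v` has the value `b`. -/
def Gate.dualRail {n : ℕ} {V : Type} : Gate n V → Bool → Gate (2 * n) (V × Bool)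
  | .input i, b => .input ⟨2 * i + b.toNat, by have := b.toNat_lt; omega⟩
  | .const c, b => .const (c == b)
  | .not a, b => .or (a, !b) (a, !b)
  | .and a c, true => .and (a, true) (c, true)
  | .and a c, false => .or (a, false) (c, false)
  | .or a c, true => .or (a, true) (c, true)
  | .or a c, false => .and (a, false) (c, false)

theorem Gate.mem_args_dualRail {n : ℕ} {V : Type} {g : Gate n V} {b : Bool} {u : V × Bool}
    (h : u ∈ (g.dualRail b).args) : u.1 ∈ g.args := by
  cases g <;> cases b <;> simp only [dualRail, args, List.mem_cons, List.not_mem_nil] at h ⊢ <;>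
    aesop

namespace Circuit

variable {n : ℕ}

/-- The monotone circuit that simulates the circuit `B` on flattened words. -/
def dualRail (B : Circuit n) : Circuit (2 * n) where
  Node := B.Node × Bool
  finite := by have := B.finite; infer_instance
  gate v := (B.gate v.1).dualRail v.2
  acyclic := Subrelation.wf (fun h => Gate.mem_args_dualRail h) (InvImage.wf Prod.fst B.acyclic)
  out := (B.out, true)

theorem size_dualRail (B : Circuit n) : B.dualRail.size = 2 * B.size := by
  simp [size, dualRail, Nat.card_prod, mul_comm]

theorem isMonotone_dualRail (B : Circuit n) : B.dualRail.IsMonotone := by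
  rintro ⟨v, b⟩ a
  change (B.gate v).dualRail b ≠ .not a
  cases B.gate v <;> cases b <;> simp [Gate.dualRail]

theorem val_dualRail (B : Circuit n) {x : Fin n → Bool} {y : Fin (2 * n) → Bool}
    (hy : ∀ (i : Fin n) (b : Bool) (h : 2 * (i : ℕ) + b.toNat < 2 * n),
      y ⟨2 * i + b.toNat, h⟩ = (x i == b)) (v : B.Node) (b : Bool) :
    B.dualRail.val y (v, b) = (B.val x v == b) := by
  induction v using B.acyclic.induction generalizing b with
  | _ v ih =>
    rw [B.val_eq]
    refine (B.dualRail.val_eq y (v, b)).trans ?_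
    change ((B.gate v).dualRail b).eval y (B.dualRail.val y) = _
    cases hg : B.gate v with
    | input i => exact hy i b _
    | const c => rfl
    | not a =>
      simp only [hg, Gate.args, List.mem_cons, List.not_mem_nil, or_false, forall_eq] at ih
      simp only [Gate.dualRail, Gate.eval, ih]
      cases B.val x a <;> cases b <;> rfl
    | and a c =>
      simp only [hg, Gate.args, List.mem_cons, List.not_mem_nil, or_false, forall_eq_or_imp,
        forall_eq] at ih
      cases b <;> simp only [Gate.dualRail, Gate.eval, ih.1, ih.2] <;>
        cases B.val x a <;> cases B.val x c <;> rfl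
    | or a c =>
      simp only [hg, Gate.args, List.mem_cons, List.not_mem_nil, or_false, forall_eq_or_imp,
        forall_eq] at ih
      cases b <;> simp only [Gate.dualRail, Gate.eval, ih.1, ih.2] <;>
        cases B.val x a <;> cases B.val x c <;> rfl

theorem dualRail_decidesOn {B : Circuit n} {L : Language Bool} (hB : B.Decides L) :
    B.dualRail.DecidesOn (Set.range flatten) (flattened L) := by
  rintro _ ⟨w, rfl⟩ hw
  rw [length_flatten] at hw
  have hn : w.length = n := by omega
  rw [flatten_mem_flattened, ← hB w trivial hn]
  have h := B.val_dualRail (x := fun i => w.getD i false)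
    (y := fun i => (flatten w).getD i false)
    (fun i b _ => getD_flatten w i (hn ▸ i.isLt) b) B.out true
  rw [beq_true] at h
  exact Bool.eq_iff_iff.1 h

end Circuit

/-! ### The computation table -/

namespace DTM

variable {M : DTM}

/-- The content of the cell `p` of the tape in a configuration, as it is written in the table. -/
def cellAt (c : M.Cfg) (p : ℤ) : M.Cell :=
  (if p = c.head then some c.state else none, c.tape p)

theorem leave_cellAt (c : M.Cfg) (p : ℤ) (d : SignType) :
    M.leave (cellAt c p) d =
      if p = c.head ∧ (M.act c.state (c.tape c.head)).2.2 = d then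
        some (M.step c).state else none := by
  by_cases hp : p = c.head
  · subst hp
    simp [leave, cellAt, step]
  · simp [leave, cellAt, hp]

/-- A step of the machine is local. -/
theorem cellAt_step (c : M.Cfg) (p : ℤ) :
    cellAt (M.step c) p = M.next (cellAt c (p - 1), cellAt c p, cellAt c (p + 1)) := by
  simp only [next, leave_cellAt]
  refine Prod.ext ?_ ?_
  · change (if p = c.head + ((M.act c.state (c.tape c.head)).2.2 : ℤ) then _ else _) = _
    generalize (M.act c.state (c.tape c.head)).2.2 = d
    cases d with
    | zero => by_cases h : p = c.head <;> simp [h]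
    | neg =>
      by_cases h : p + 1 = c.head
      · simp [show p = c.head + -1 by omega]
      · simp [h, show p ≠ c.head + -1 by omega]
    | pos =>
      by_cases h : p - 1 = c.head
      · simp [show p = c.head + 1 by omega]
      · simp [h, show p ≠ c.head + 1 by omega]
  · by_cases h : p = c.head
    · subst h
      simp [cellAt, step]
    · simp [cellAt, step, h]

theorem abs_head_le (w : List Bool) (t : ℕ) : |(M.step^[t] (M.init w)).head| ≤ t := by
  induction t with
  | zero => simp [init]
  | succ t ih =>
    rw [Function.iterate_succ_apply']
    generalize M.step^[t] (M.init w) = c at ih ⊢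
    change |c.head + ((M.act c.state (c.tape c.head)).2.2 : ℤ)| ≤ _
    have hd : |((M.act c.state (c.tape c.head)).2.2 : ℤ)| ≤ 1 := by
      generalize (M.act c.state (c.tape c.head)).2.2 = d
      cases d <;> simp
    have := abs_add_le c.head ((M.act c.state (c.tape c.head)).2.2 : ℤ)
    push_cast
    omega

/-- A cell changes only if the head is on it before or after the step. -/
theorem cellAt_step_of_ne (c : M.Cfg) (p : ℤ) (h : p ≠ c.head) (h' : p ≠ (M.step c).head) :
    cellAt (M.step c) p = cellAt c p := by
  simp [cellAt, h, h', show (M.step c).tape p = c.tape p by simp [step, h]]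

theorem cellAt_init (w : List Bool) (p : ℤ) :
    cellAt (M.init w) p = M.initCell p (if 0 ≤ p then w[p.toNat]? else none) :=
  rfl

/-! ### Correctness of the circuit obtained from a machine -/

section Circuit

variable {n τ : ℕ} (x : Fin n → Bool)

/-- The value that a node of the circuit obtained from a machine takes on the input `x`. -/
noncomputable def tableVal (M : DTM) (τ : ℕ) (x : Fin n → Bool) : TableNode M n τ → Bool :=
  (M.circuit n τ).val x

theorem tableVal_eq (v : TableNode M n τ) : tableVal M τ x v = v.gate.eval x (tableVal M τ x) :=
  (M.circuit n τ).val_eq x v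

/-- The chain is the disjunction, accumulated one triple at a time, of the first `m` triples that
lead to the content `k`. -/
theorem tableVal_chain (t : Fin τ) (j : Fin (2 * τ + 1)) (k : M.Cell)
    (m : Fin (M.numTriples + 1)) :
    tableVal M τ x (.chain t j k m) = true ↔
      ∃ i : Fin M.numTriples, (i : ℕ) < m ∧ M.next ((Fintype.equivFin _).symm i) = k ∧
        tableVal M τ x (.triple t j ((Fintype.equivFin _).symm i)) = true := by
  induction m using Fin.induction with
  | zero => rw [tableVal_eq]; simp [TableNode.gate, Gate.eval]
  | succ m ih =>
    have key : tableVal M τ x (.chain t j k m.succ) = true ↔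
        tableVal M τ x (.chain t j k m.castSucc) = true ∨
        (M.next ((Fintype.equivFin _).symm m) = k ∧
          tableVal M τ x (.triple t j ((Fintype.equivFin _).symm m)) = true) := by
      rw [tableVal_eq]
      simp only [TableNode.gate, Fin.cases_succ]
      split_ifs with h <;> simp [Gate.eval, TableNode.copy, h]
    rw [key, ih]
    constructor
    · rintro (⟨i, hi, h⟩ | h)
      · exact ⟨i, hi.trans (by simp), h⟩
      · exact ⟨m, by simp, h⟩
    · rintro ⟨i, hi, h⟩
      rcases Nat.lt_succ_iff_lt_or_eq.1 (by simpa using hi : (i : ℕ) < m + 1) with hlt | heq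
      · exact .inl ⟨i, hlt, h⟩
      · exact .inr (Fin.ext heq ▸ h)

theorem tableVal_final (m : Fin (M.numFinal τ + 1)) :
    tableVal M τ x (.final m) = true ↔
      ∃ i : Fin (M.numFinal τ), (i : ℕ) < m ∧
        tableVal M τ x (.cell (Fin.last τ)
          ((Fintype.equivFin (Fin (2 * τ + 3) × M.Γ)).symm i).1
          (some M.accept, ((Fintype.equivFin (Fin (2 * τ + 3) × M.Γ)).symm i).2)) = true := by
  induction m using Fin.induction with
  | zero => rw [tableVal_eq]; simp [TableNode.gate, Gate.eval]
  | succ m ih =>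
    have key : tableVal M τ x (.final m.succ) = true ↔
        tableVal M τ x (.final m.castSucc) = true ∨
        tableVal M τ x (.cell (Fin.last τ)
          ((Fintype.equivFin (Fin (2 * τ + 3) × M.Γ)).symm m).1
          (some M.accept, ((Fintype.equivFin (Fin (2 * τ + 3) × M.Γ)).symm m).2)) = true := by
      rw [tableVal_eq]
      simp only [TableNode.gate, Fin.cases_succ, Gate.eval, Bool.or_eq_true]
    rw [key, ih]
    constructor
    · rintro (⟨i, hi, h⟩ | h)
      · exact ⟨i, hi.trans (by simp), h⟩
      · exact ⟨m, by simp, h⟩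
    · rintro ⟨i, hi, h⟩
      rcases Nat.lt_succ_iff_lt_or_eq.1 (by simpa using hi : (i : ℕ) < m + 1) with hlt | heq
      · exact .inl ⟨i, hlt, h⟩
      · exact .inr (Fin.ext heq ▸ h)

theorem tableVal_triple (t : Fin τ) (j : Fin (2 * τ + 1)) (e : M.Cell × M.Cell × M.Cell) :
    tableVal M τ x (.triple t j e) = true ↔
      tableVal M τ x (.cell t.castSucc ⟨j, by omega⟩ e.1) = true ∧
      tableVal M τ x (.cell t.castSucc ⟨j + 1, by omega⟩ e.2.1) = true ∧
      tableVal M τ x (.cell t.castSucc ⟨j + 2, by omega⟩ e.2.2) = true := by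
  have h₁ := tableVal_eq x (.triple t j e)
  have h₂ := tableVal_eq x (.pair t j e.1 e.2.1)
  simp only [TableNode.gate, Gate.eval] at h₁ h₂
  rw [h₁, h₂]
  simp only [Bool.and_eq_true, and_assoc]

theorem tableVal_lit (i : Fin n) (b : Bool) :
    tableVal M τ x (.lit i b) = true ↔ x i = b := by
  have h₁ : tableVal M τ x (.lit i true) = x i := tableVal_eq x (.lit i true)
  cases b with
  | true => rw [h₁]
  | false =>
    have h₂ : tableVal M τ x (.lit i false) = !tableVal M τ x (.lit i true) :=
      tableVal_eq x (.lit i false)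
    rw [h₂, h₁]
    simp

theorem initCell_injective (p : ℤ) : Function.Injective (M.initCell p) := fun _ _ h =>
  M.sym.injective (congrArg Prod.snd h)

/-- The gates of row `0` describe the initial configuration. -/
theorem tableVal_cell_zero (w : List Bool) (hw : w.length = n) (p : Fin (2 * τ + 3))
    (k : M.Cell) :
    tableVal M τ (fun i : Fin n => w.getD i false) (.cell 0 p k) = true ↔
      k = cellAt (M.init w) ((p : ℤ) - (τ + 1)) := by
  rw [tableVal_eq, cellAt_init]
  simp only [TableNode.gate, Fin.cases_zero, TableNode.initGate]
  by_cases h : τ + 1 ≤ (p : ℕ) ∧ (p : ℕ) - (τ + 1) < n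
  · have h0 : (0 : ℤ) ≤ (p : ℤ) - (τ + 1) := by omega
    have e : ((p : ℤ) - (τ + 1)).toNat = (p : ℕ) - (τ + 1) := by omega
    have hlt : (p : ℕ) - (τ + 1) < w.length := hw ▸ h.2
    rw [dif_pos h, if_pos h0, e, List.getElem?_eq_getElem hlt]
    split_ifs with h₁ h₂
    · simp only [Gate.eval, TableNode.copy, Bool.or_self, tableVal_lit, h₁,
        (initCell_injective _).eq_iff, List.getD_eq_getElem _ _ hlt, Option.some.injEq]
      exact eq_comm
    · simp only [Gate.eval, TableNode.copy, Bool.or_self, tableVal_lit, h₂,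
        (initCell_injective _).eq_iff, List.getD_eq_getElem _ _ hlt, Option.some.injEq]
      exact eq_comm
    · cases hb : w[(p : ℕ) - (τ + 1)] <;> simp [Gate.eval, h₁, h₂]
  · have e : (if 0 ≤ (p : ℤ) - (τ + 1) then w[((p : ℤ) - (τ + 1)).toNat]? else none) = none := by
      split_ifs with h0
      · exact List.getElem?_eq_none (by omega)
      · rfl
    rw [dif_neg h, e]
    simp [Gate.eval]

/-- Row `t` of the table describes the configuration at time `t`. -/
theorem tableVal_cell (w : List Bool) (hw : w.length = n) (t : Fin (τ + 1)) (p : Fin (2 * τ + 3))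
    (k : M.Cell) :
    tableVal M τ (fun i : Fin n => w.getD i false) (.cell t p k) = true ↔
      k = cellAt (M.step^[t] (M.init w)) ((p : ℤ) - (τ + 1)) := by
  induction t using Fin.induction generalizing p k with
  | zero => exact tableVal_cell_zero w hw p k
  | succ t ih =>
    rw [tableVal_eq]
    simp only [TableNode.gate, Fin.cases_succ, TableNode.nextGate, Fin.val_succ,
      Function.iterate_succ_apply']
    simp only [Fin.val_castSucc] at ih
    by_cases h : 0 < (p : ℕ) ∧ (p : ℕ) < 2 * τ + 2
    · rw [dif_pos h]
      simp only [TableNode.copy, Gate.eval, Bool.or_self, tableVal_chain, tableVal_triple, ih]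
      have e₁ : (((p : ℕ) - 1 : ℕ) : ℤ) - (τ + 1) = (p : ℤ) - (τ + 1) - 1 := by omega
      have e₂ : (((p : ℕ) - 1 + 1 : ℕ) : ℤ) - (τ + 1) = (p : ℤ) - (τ + 1) := by omega
      have e₃ : (((p : ℕ) - 1 + 2 : ℕ) : ℤ) - (τ + 1) = (p : ℤ) - (τ + 1) + 1 := by omega
      rw [e₁, e₂, e₃, cellAt_step]
      constructor
      · rintro ⟨i, -, h₀, h₁, h₂, h₃⟩
        rw [← h₀, ← h₁, ← h₂, ← h₃]
      · intro hk
        exact ⟨Fintype.equivFin _ (_, _, _), Fin.isLt _,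
          by rw [Equiv.symm_apply_apply]; exact hk.symm,
          by rw [Equiv.symm_apply_apply], by rw [Equiv.symm_apply_apply],
          by rw [Equiv.symm_apply_apply]⟩
    · -- In the outermost columns the head can be neither at time `t` nor at time `t + 1`.
      rw [dif_neg h]
      simp only [TableNode.copy, Gate.eval, Bool.or_self, ih]
      have hp : (p : ℕ) = 0 ∨ (p : ℕ) = 2 * τ + 2 := by omega
      have h₁ := abs_le.1 (abs_head_le (M := M) w t)
      have h₂ := abs_le.1 (abs_head_le (M := M) w (t + 1))
      rw [Function.iterate_succ_apply'] at h₂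
      push_cast at h₂
      rw [cellAt_step_of_ne] <;> omega

/-- The circuit accepts exactly if the machine is in the accepting state at time `τ`. -/
theorem circuit_accepts (w : List Bool) (hw : w.length = n) :
    (M.circuit n τ).Accepts w ↔ (M.step^[τ] (M.init w)).state = M.accept := by
  have h₁ := abs_le.1 (abs_head_le (M := M) w τ)
  change tableVal M τ _ (.final (Fin.last _)) = true ↔ _
  simp only [tableVal_final, tableVal_cell w hw, Fin.val_last]
  generalize M.step^[τ] (M.init w) = c at h₁ ⊢
  constructor
  · rintro ⟨i, -, h⟩
    have h := congrArg Prod.fst h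
    simp only [cellAt] at h
    split_ifs at h
    exact (Option.some.inj h).symm
  · intro h
    -- the column that contains the head
    obtain ⟨p, hp⟩ : ∃ p : Fin (2 * τ + 3), (p : ℤ) - (τ + 1) = c.head :=
      ⟨⟨(c.head + (τ + 1)).toNat, by omega⟩, by simp only; omega⟩
    refine ⟨Fintype.equivFin _ (p, c.tape c.head), Fin.isLt _, ?_⟩
    simp only [Equiv.symm_apply_apply, hp, cellAt, h, if_true]

end Circuit

theorem circuit_decides {L : Language Bool} {T : ℕ → ℕ} (h : M.DecidesInTime L T) (n : ℕ) :
    (M.circuit n (T n)).Decides L := by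
  intro w _ hw
  rw [circuit_accepts w hw, ← hw]
  refine ⟨fun ha => ?_, (h w).1⟩
  by_contra hL
  exact M.accept_ne_reject (ha.symm.trans ((h w).2 hL))

/-! ### Size of the circuit obtained from a machine -/

/-- The nodes of the circuit as a disjoint union. -/
def TableNode.equivSum (M : DTM) (n τ : ℕ) :
    TableNode M n τ ≃ (Fin n × Bool) ⊕ (Fin (τ + 1) × Fin (2 * τ + 3) × M.Cell) ⊕
      (Fin τ × Fin (2 * τ + 1) × M.Cell × M.Cell) ⊕
      (Fin τ × Fin (2 * τ + 1) × (M.Cell × M.Cell × M.Cell)) ⊕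
      (Fin τ × Fin (2 * τ + 1) × M.Cell × Fin (M.numTriples + 1)) ⊕
      Fin (M.numFinal τ + 1) where
  toFun
    | .lit i b => .inl (i, b)
    | .cell t p k => .inr (.inl (t, p, k))
    | .pair t j l c => .inr (.inr (.inl (t, j, l, c)))
    | .triple t j e => .inr (.inr (.inr (.inl (t, j, e))))
    | .chain t j k m => .inr (.inr (.inr (.inr (.inl (t, j, k, m)))))
    | .final m => .inr (.inr (.inr (.inr (.inr m))))
  invFun
    | .inl (i, b) => .lit i b
    | .inr (.inl (t, p, k)) => .cell t p k
    | .inr (.inr (.inl (t, j, l, c))) => .pair t j l c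
    | .inr (.inr (.inr (.inl (t, j, e)))) => .triple t j e
    | .inr (.inr (.inr (.inr (.inl (t, j, k, m))))) => .chain t j k m
    | .inr (.inr (.inr (.inr (.inr m)))) => .final m
  left_inv v := by cases v <;> rfl
  right_inv v := by rcases v with _ | _ | _ | _ | _ | _ <;> rfl

theorem size_circuit (M : DTM) (n τ : ℕ) :
    (M.circuit n τ).size = n * 2 + ((τ + 1) * ((2 * τ + 3) * Fintype.card M.Cell) +
      (τ * ((2 * τ + 1) * (Fintype.card M.Cell * Fintype.card M.Cell)) +
      (τ * ((2 * τ + 1) * M.numTriples) +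
      (τ * ((2 * τ + 1) * (Fintype.card M.Cell * (M.numTriples + 1))) +
      ((2 * τ + 3) * Fintype.card M.Γ + 1))))) := by
  refine (Nat.card_congr (TableNode.equivSum M n τ)).trans ?_
  rw [Nat.card_eq_fintype_card]
  simp only [Fintype.card_sum, Fintype.card_prod, Fintype.card_fin, Fintype.card_bool, numTriples,
    numFinal]

theorem exists_polynomial_circuit_size_le (M : DTM) (T : Polynomial ℕ) :
    ∃ r : Polynomial ℕ, ∀ n, (M.circuit n (T.eval n)).size ≤ r.eval n := by
  refine ⟨.X * 2 + ((T + 1) * ((2 * T + 3) * .C (Fintype.card M.Cell)) +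
      (T * ((2 * T + 1) * (.C (Fintype.card M.Cell) * .C (Fintype.card M.Cell))) +
      (T * ((2 * T + 1) * .C M.numTriples) +
      (T * ((2 * T + 1) * (.C (Fintype.card M.Cell) * (.C M.numTriples + 1))) +
      ((2 * T + 3) * .C (Fintype.card M.Γ) + 1))))), fun n => ?_⟩
  rw [size_circuit]
  simp

end DTM

/-! ### Circuits of least size -/

/-- Every language in P has, at each length, a deciding circuit of least size, because it has
deciding circuits at all. -/
theorem InP.exists_minimal_circuit {L : Language Bool} (hL : InP L) (n : ℕ) :
    ∃ B : Circuit n, B.Decides L ∧ ∀ B' : Circuit n, B'.Decides L → B.size ≤ B'.size := by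
  obtain ⟨M, T, hM⟩ := hL
  have hne : {B : Circuit n | B.Decides L}.Nonempty := ⟨_, M.circuit_decides hM n⟩
  obtain ⟨B, hB, hmin⟩ := (measure (Circuit.size (n := n))).wf.has_min _ hne
  exact ⟨B, hB, fun B' hB' => not_lt.1 (hmin B' hB')⟩

theorem mainTheorem3 :
    ∃ q : Polynomial ℕ, ∀ L : Language Bool, PComplete L →
      ∃ C : (n : ℕ) → Circuit (2 * n),
        (∀ n, (C n).IsMonotone) ∧
        (∀ n, (C n).DecidesOn (Set.range flatten) (flattened L)) ∧
        (∃ p : Polynomial ℕ, ∀ n, (C n).size ≤ p.eval n) ∧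
        (∀ (n : ℕ) (B : Circuit n), B.Decides L → (C n).size ≤ q.eval B.size) ∧
        (∀ (M : DTM) (T : Polynomial ℕ), (M.DecidesInTime L fun n => T.eval n) →
          (∀ n, (M.circuit n (T.eval n)).Decides L) ∧
          (∀ n, (C n).size ≤ q.eval (M.circuit n (T.eval n)).size) ∧
          ∃ r : Polynomial ℕ, ∀ n, (M.circuit n (T.eval n)).size ≤ r.eval n) := by
  refine ⟨2 * .X, fun L hL => ?_⟩
  choose B hB hmin using hL.1.exists_minimal_circuit
  have hq : ∀ (n : ℕ) (B' : Circuit n), B'.Decides L →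
      (B n).dualRail.size ≤ (2 * .X : Polynomial ℕ).eval B'.size := by
    intro n B' hB'
    rw [Circuit.size_dualRail]
    simpa using hmin n B' hB'
  refine ⟨fun n => (B n).dualRail, fun n => (B n).isMonotone_dualRail,
    fun n => Circuit.dualRail_decidesOn (hB n), ?_, hq, fun M T hM => ?_⟩
  · obtain ⟨M, T, hM⟩ := hL.1
    obtain ⟨r, hr⟩ := M.exists_polynomial_circuit_size_le T
    refine ⟨2 * r, fun n => (hq n _ (M.circuit_decides hM n)).trans ?_⟩
    simpa using hr n
  · exact ⟨M.circuit_decides hM, fun n => hq n _ (M.circuit_decides hM n),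
      M.exists_polynomial_circuit_size_le T⟩
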